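/- Let $A$ and $B$ be (discrete) groups and let $(\sigma_i)_{i}$ be a sequence of bilinear maps $\sigma_i : A\times B\to\mathbb T$ (i.e. homomorphisms in each variable separately), where $\mathbb T$ is the circle group. For $a\in A$, $b\in B$ let $U_i(a,b)=V_{\sigma_i}(a)\lambda_B(b)$ be the unitary on $\ell^2(B)$ where $V_{\sigma_i}(a)$ is multiplication by the function $\sigma_i(a,\cdot)$ and $(\lambda_B(b)f)(x)=f(b^{-1}x)$ is the left regular representation. For a sequence $\phi=(\phi_i)$ of unit vectors in $\ell^2(B)$, let $\bigotimes_i^{\phi}\ell^2(B)$ be the infinite tensor product Hilbert space along $\phi$, i.e. the Hilbert space spanned by the elementary vectors $\otimes_i\psi_i$ with $\psi_i=\phi_i$ for all but finitely many $i$, with $(\otimes_i\psi_i,\otimes_i\xi_i)=\prod_i(\psi_i,\xi_i)$. For unitaries $T_i$ on $\ell^2(B)$ one says that $\otimes_iT_i$ exists on $\bigotimes_i^{\phi}\ell^2(B)$ if the net of operators $\tilde T_J$ ($J\subset\mathbb N$ finite, ordered by inclusion), where $\tilde T_J$ acts as $T_i$ on the factors $i\in J$ and trivially on the other factors, converges in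 the strong operator topology to a bounded operator. One says that $\otimes_iU_i$ exists on $\bigotimes_i^{\phi}\ell^2(B)$ if $\otimes_iU_i(a,b)$ exists there for all $(a,b)\in A\times B$. The group $B$ is amenable if there is a left invariant mean on $\ell^\infty(B)$. A $\sigma F$-sequence for $B$ is a sequence $(F_i)$ of non-empty finite subsets of $B$ with $\sum_i\left|1-\frac{\#(F_i\cap bF_i)}{\#F_i}\right|<\infty$ for all $b\in B$. (i) If $\otimes_iU_i$ exists on $\bigotimes_i^{\phi}\ell^2(B)$ for some sequence $\phi$ of unit vectors in $\ell^2(B)$, then $B$ is countable and amenable. (ii) Assume that $B$ is countable and amenable, and that $(F_i)$ is a $\sigma F$-sequence for $B$ satisfying $$\sum_i\frac1{\#F_i}\sum_{b\in F_i}|1-\sigma_i(a,b)|<\infty\qquad\text{for every }a\in A.$$ Let $\phi_i=\chi_{F_i}/(\#F_i)^{1/2}$ and $\phi=(\phi_i)$. Then $\otimes_iU_i$ exists on $\bigotimes_i^{\phi}\ell^2(B)$. -/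

import Mathlib

open scoped ENNReal Topology Pointwise ComplexConjugate ComplexOrder

noncomputable section

/-! ### The infinite tensor product of Hilbert spaces along a sequence of unit vectors -/

/-- A sequence of unit vectors, one in each of the spaces `H 0, H 1, H 2, …`. -/
structure UnitSeq (H : ℕ → Type*) [∀ i, NormedAddCommGroup (H i)] where
  vec : ∀ i, H i
  norm_vec : ∀ i, ‖vec i‖ = 1

namespace InfTensor

variable {H : ℕ → Type*} [∀ i, NormedAddCommGroup (H i)] [∀ i, InnerProductSpace ℂ (H i)]

/-- The index of an elementary decomposable vector `⊗ ψ i`: a sequence `ψ` with `ψ i = φ i` for all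
but finitely many `i`. -/
structure Elem (φ : UnitSeq H) where
  val : ∀ i, H i
  finite : {i | val i ≠ φ.vec i}.Finite

/-- The inner product `∏ i, ⟪ψ i, ξ i⟫` of two elementary decomposable vectors (all but finitely many
factors are equal to `1`). -/
def kernel (φ : UnitSeq H) (ψ ξ : Elem φ) : ℂ :=
  ∏ᶠ i, inner ℂ (ψ.val i) (ξ.val i)

theorem kernel_eq_prod (φ : UnitSeq H) (ψ ξ : Elem φ) (J : Finset ℕ)
    (h₁ : ∀ i, i ∉ J → ψ.val i = φ.vec i) (h₂ : ∀ i, i ∉ J → ξ.val i = φ.vec i) :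
    kernel φ ψ ξ = ∏ i ∈ J, inner ℂ (ψ.val i) (ξ.val i) := by
  refine finprod_eq_prod_of_mulSupport_subset _ fun i hi => ?_
  by_contra hJ
  apply hi
  have hJ' : i ∉ J := by simpa using hJ
  beta_reduce
  rw [h₁ i hJ', h₂ i hJ', inner_self_eq_norm_sq_to_K, φ.norm_vec i]
  simp

theorem conj_kernel (φ : UnitSeq H) (ψ ξ : Elem φ) : conj (kernel φ ψ ξ) = kernel φ ξ ψ := by
  rw [kernel_eq_prod φ ξ ψ (ξ.finite.toFinset ∪ ψ.finite.toFinset) (by simp +contextual)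
    (by simp +contextual), kernel_eq_prod φ ψ ξ (ξ.finite.toFinset ∪ ψ.finite.toFinset)
    (by simp +contextual) (by simp +contextual), map_prod]
  exact Finset.prod_congr rfl fun i _ => inner_conj_symm _ _

/-- The inner products of elementary decomposable vectors form a positive semidefinite kernel. -/
theorem kernel_nonneg (φ : UnitSeq H) (s : Finset (Elem φ)) (c : Elem φ → ℂ) :
    0 ≤ ∑ ψ ∈ s, ∑ ξ ∈ s, conj (c ψ) * c ξ * kernel φ ψ ξ := by
  classical
  have key : ∀ K : Finset ℕ,
      (Matrix.of fun ψ ξ : s => ∏ i ∈ K, (inner ℂ (ψ.1.val i) (ξ.1.val i) : ℂ)).PosSemidef := by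
    intro K
    induction K using Finset.induction_on with
    | empty =>
      convert! Matrix.posSemidef_gram ℂ (fun _ : s => (1 : ℂ)) using 1
      ext ψ ξ
      simp [Matrix.gram_apply]
    | insert i K hi ih =>
      convert! (Matrix.posSemidef_gram ℂ (fun ψ : s => ψ.1.val i)).hadamard ih using 1
      ext ψ ξ
      simp [Matrix.gram_apply, Finset.prod_insert hi]
  have hJ : ∀ ψ ∈ s, ∀ i, i ∉ (s.biUnion fun ψ => ψ.finite.toFinset) → ψ.val i = φ.vec i := by
    intro ψ hψ i hi
    by_contra hne
    exact hi (Finset.mem_biUnion.2 ⟨ψ, hψ, by simpa using hne⟩)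
  have h := (key (s.biUnion fun ψ => ψ.finite.toFinset)).dotProduct_mulVec_nonneg (fun ψ => c ψ.1)
  simp only [dotProduct, Matrix.mulVec, Matrix.of_apply, Pi.star_apply, Finset.mul_sum] at h
  refine h.trans_eq ?_
  rw [← Finset.sum_coe_sort s]
  refine Finset.sum_congr rfl fun ψ _ => ?_
  rw [← Finset.sum_coe_sort s]
  refine Finset.sum_congr rfl fun ξ _ => ?_
  rw [kernel_eq_prod φ ψ ξ _ (hJ ψ ψ.2) (hJ ξ ξ.2), starRingEnd_apply]
  ring

/-- The formal linear combinations of elementary decomposable vectors, with the positive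
semidefinite sesquilinear form determined by `⟪⊗ ψ i, ⊗ ξ i⟫ = ∏ i, ⟪ψ i, ξ i⟫`. -/
abbrev Pre (φ : UnitSeq H) : Type _ := Elem φ →₀ ℂ

/-- The sesquilinear form on formal linear combinations, conjugate linear in the first variable. -/
def preInner (φ : UnitSeq H) (f g : Pre φ) : ℂ :=
  f.sum fun ψ c => g.sum fun ξ d => conj c * d * kernel φ ψ ξ

abbrev preCore (φ : UnitSeq H) : PreInnerProductSpace.Core ℂ (Pre φ) where
  inner f g := preInner φ f g
  conj_inner_symm f g := by
    unfold preInner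
    rw [Finsupp.sum_comm]
    simp only [Finsupp.sum, map_sum, map_mul, Complex.conj_conj]
    refine Finset.sum_congr rfl fun ψ _ => Finset.sum_congr rfl fun ξ _ => ?_
    rw [conj_kernel]
    ring
  re_inner_nonneg f := (RCLike.nonneg_iff.1 (kernel_nonneg φ f.support f)).1
  add_left f g h := by
    unfold preInner
    exact Finsupp.sum_add_index' (by simp) (by simp [← Finsupp.sum_add, add_mul])
  smul_left f g r := by
    unfold preInner
    refine (Finsupp.sum_smul_index (by simp)).trans ?_
    rw [Finsupp.mul_sum]
    refine Finset.sum_congr rfl fun ψ _ => ?_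
    dsimp only
    rw [Finsupp.mul_sum]
    refine Finset.sum_congr rfl fun ξ _ => ?_
    simp only [map_mul]
    ring

instance (φ : UnitSeq H) : SeminormedAddCommGroup (Pre φ) :=
  letI := preCore φ
  InnerProductSpace.Core.toSeminormedAddCommGroup (𝕜 := ℂ)

instance (φ : UnitSeq H) : InnerProductSpace ℂ (Pre φ) := .ofCore (preCore φ)

/-- The infinite tensor product Hilbert space `⊗^φ H i`: the (separated) completion of the space
spanned by the elementary decomposable vectors. -/
abbrev Space (φ : UnitSeq H) : Type _ := UniformSpace.Completion (Pre φ)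

/-- The elementary decomposable vector `⊗ ψ i` in `⊗^φ H i`. -/
def tmul {φ : UnitSeq H} (ψ : Elem φ) : Space φ :=
  ((Finsupp.single ψ 1 : Pre φ) : UniformSpace.Completion (Pre φ))

theorem inner_tmul {φ : UnitSeq H} (ψ ξ : Elem φ) :
    inner ℂ (tmul ψ) (tmul ξ) = ∏ᶠ i, inner ℂ (ψ.val i) (ξ.val i) := by
  refine (UniformSpace.Completion.inner_coe _ _).trans ?_
  change preInner φ (Finsupp.single ψ 1) (Finsupp.single ξ 1) = _
  simp [preInner, kernel]

/-- The sequence which is `T i (ψ i)` for `i ∈ J` and `ψ i` for `i ∉ J`. -/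
def applyOn {φ : UnitSeq H} (T : ∀ i, H i ≃ₗᵢ[ℂ] H i) (J : Finset ℕ) (ψ : Elem φ) : Elem φ :=
  ⟨fun i => if i ∈ J then T i (ψ.val i) else ψ.val i, by
    refine (J.finite_toSet.union ψ.finite).subset fun i hi => ?_
    by_cases hJ : i ∈ J
    · exact Or.inl hJ
    · right
      simpa [hJ] using hi⟩

theorem kernel_applyOn {φ : UnitSeq H} (T : ∀ i, H i ≃ₗᵢ[ℂ] H i) (J : Finset ℕ) (ψ ξ : Elem φ) :
    kernel φ (applyOn T J ψ) (applyOn T J ξ) = kernel φ ψ ξ := by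
  unfold kernel
  refine finprod_congr fun i => ?_
  by_cases hJ : i ∈ J <;> simp [applyOn, hJ]

def preOn (φ : UnitSeq H) (T : ∀ i, H i ≃ₗᵢ[ℂ] H i) (J : Finset ℕ) : Pre φ →ₗᵢ[ℂ] Pre φ :=
  LinearMap.isometryOfInner
    (Finsupp.lmapDomain ℂ ℂ (applyOn (φ := φ) T J)) fun f g => by
      change preInner φ (Finsupp.mapDomain (applyOn T J) f) (Finsupp.mapDomain (applyOn T J) g) =
        preInner φ f g
      unfold preInner
      rw [Finsupp.sum_mapDomain_index (by simp) (by simp [← Finsupp.sum_add, add_mul])]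
      refine Finset.sum_congr rfl fun ψ _ => ?_
      dsimp only
      rw [Finsupp.sum_mapDomain_index (by simp) (by intros; ring)]
      simp only [kernel_applyOn]

/-- For unitaries `T i` on `H i` and a finite set `J` of indices, the operator on `⊗^φ H i` which acts
as `T i` on the factors with `i ∈ J` and trivially on the other factors. -/
def opOn (φ : UnitSeq H) (T : ∀ i, H i ≃ₗᵢ[ℂ] H i) (J : Finset ℕ) : Space φ →L[ℂ] Space φ :=
  (preOn φ T J).toContinuousLinearMap.completion

theorem opOn_tmul (φ : UnitSeq H) (T : ∀ i, H i ≃ₗᵢ[ℂ] H i) (J : Finset ℕ) (ψ : Elem φ) :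
    opOn φ T J (tmul ψ) = tmul (applyOn T J ψ) := by
  refine (ContinuousLinearMap.completion_apply_coe _ _).trans ?_
  change ((Finsupp.mapDomain (applyOn T J) (Finsupp.single ψ 1) : Pre φ) :
    UniformSpace.Completion (Pre φ)) = _
  rw [Finsupp.mapDomain_single]
  rfl

/-- `⊗ T i` exists on `⊗^φ H i`: the net of the operators `opOn φ T J`, indexed by the finite sets
`J` ordered by inclusion, converges strongly to a bounded operator. -/
def OpExists (φ : UnitSeq H) (T : ∀ i, H i ≃ₗᵢ[ℂ] H i) : Prop :=
  ∃ S : Space φ →L[ℂ] Space φ,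
    ∀ v : Space φ, Filter.Tendsto (fun J : Finset ℕ => opOn φ T J v) Filter.atTop (𝓝 (S v))

/-- `⊗ U i` exists on `⊗^φ H i` for maps `U i` from `G` to the unitaries on `H i`: the operator
`⊗ U i x` exists for every `x`. -/
def RepExists {G : Type*} (φ : UnitSeq H) (U : ∀ i, G → (H i ≃ₗᵢ[ℂ] H i)) : Prop :=
  ∀ x : G, OpExists φ fun i => U i x

end InfTensor

/-! ### The representations `U_σ` on `ℓ²(B)` -/

/-- The Hilbert space `ℓ²(B)`. -/
abbrev EllTwo (B : Type*) : Type _ := lp (fun _ : B => ℂ) 2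

theorem EllTwo.memℓp_iff {B : Type*} (f : B → ℂ) :
    Memℓp f 2 ↔ Summable fun x => ‖f x‖ ^ (2 : ℝ) := by
  simpa using memℓp_gen_iff (E := fun _ : B => ℂ) (f := f) (p := 2) (by norm_num)

theorem EllTwo.norm_eq {B : Type*} (f : EllTwo B) :
    ‖f‖ = (∑' x, ‖f x‖ ^ (2 : ℝ)) ^ (1 / (2 : ℝ)) := by
  simpa using lp.norm_eq_tsum_rpow (p := 2) (by norm_num) f

/-- The left regular representation: `(λ_B(b) f)(x) = f(b⁻¹ x)`. -/
def leftReg {B : Type*} [Group B] (b : B) : EllTwo B ≃ₗᵢ[ℂ] EllTwo B where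
  toFun f := ⟨fun x => f (b⁻¹ * x), (EllTwo.memℓp_iff _).2
    ((EllTwo.memℓp_iff _).1 f.2 |>.comp_injective (mul_right_injective b⁻¹))⟩
  invFun f := ⟨fun x => f (b * x), (EllTwo.memℓp_iff _).2
    ((EllTwo.memℓp_iff _).1 f.2 |>.comp_injective (mul_right_injective b))⟩
  map_add' _ _ := rfl
  map_smul' _ _ := rfl
  left_inv f := by
    ext x
    exact congrArg f (inv_mul_cancel_left b x)
  right_inv f := by
    ext x
    exact congrArg f (mul_inv_cancel_left b x)
  norm_map' f := by
    rw [EllTwo.norm_eq, EllTwo.norm_eq]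
    congr 1
    exact (Equiv.mulLeft b⁻¹).tsum_eq (fun x => ‖f x‖ ^ (2 : ℝ))

/-- Multiplication by a function `h : B → 𝕋` on `ℓ²(B)`. -/
def mulOp {B : Type*} (h : B → Circle) : EllTwo B ≃ₗᵢ[ℂ] EllTwo B where
  toFun f := ⟨fun x => (h x : ℂ) * f x, (EllTwo.memℓp_iff _).2
    (by simpa only [norm_mul, Circle.norm_coe, one_mul] using (EllTwo.memℓp_iff _).1 f.2)⟩
  invFun f := ⟨fun x => ((h x)⁻¹ : Circle) * f x, (EllTwo.memℓp_iff _).2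
    (by simpa only [norm_mul, Circle.norm_coe, one_mul] using (EllTwo.memℓp_iff _).1 f.2)⟩
  map_add' _ _ := by
    ext x
    exact mul_add _ _ _
  map_smul' _ _ := by
    ext x
    exact mul_left_comm _ _ _
  left_inv f := by
    ext x
    simp
  right_inv f := by
    ext x
    simp
  norm_map' f := by
    rw [EllTwo.norm_eq, EllTwo.norm_eq]
    congr 1
    refine tsum_congr fun x => ?_
    change ‖(h x : ℂ) * f x‖ ^ (2 : ℝ) = _
    rw [norm_mul, Circle.norm_coe, one_mul]

/-- The unitary `U_σ(a, b) = V_σ(a) λ_B(b)` on `ℓ²(B)`, where `V_σ(a)` is multiplication by the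
function `σ(a, ·)`. -/
def ccrRep {A B : Type*} [Group A] [Group B] (σ : A →* B →* Circle) (g : A × B) :
    EllTwo B ≃ₗᵢ[ℂ] EllTwo B :=
  (leftReg g.2).trans (mulOp fun x => σ g.1 x)

/-- The CCR-relation `V_σ(a) λ_B(b) = σ(a, b) λ_B(b) V_σ(a)`. -/
theorem ccr_relation {A B : Type*} [Group A] [Group B] (σ : A →* B →* Circle) (a : A) (b : B)
    (f : EllTwo B) :
    mulOp (fun x => σ a x) (leftReg b f) =
      (σ a b : ℂ) • leftReg b (mulOp (fun x => σ a x) f) := by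
  ext x
  change (σ a x : ℂ) * f (b⁻¹ * x) = (σ a b : ℂ) * ((σ a (b⁻¹ * x) : ℂ) * f (b⁻¹ * x))
  rw [← mul_assoc, ← Circle.coe_mul, ← map_mul, mul_inv_cancel_left]

/-! ### Amenability and summable Følner sequences -/

/-- A discrete group is amenable if there is a left invariant mean on `ℓ^∞(B)`. -/
def IsAmenable (B : Type*) [Group B] : Prop :=
  ∃ m : lp (fun _ : B => ℝ) ∞ →ₗ[ℝ] ℝ,
    (∀ f, (∀ x, 0 ≤ f x) → 0 ≤ m f) ∧ m 1 = 1 ∧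
      ∀ (b : B) (f g : lp (fun _ : B => ℝ) ∞), (∀ x, g x = f (b⁻¹ * x)) → m g = m f

/-- A `σF`-sequence for `B`: non-empty finite subsets `F i` such that
`∑ i, |1 - #(F i ∩ b F i) / #(F i)| < ∞` for all `b`. -/
structure IsSigmaFSeq {B : Type*} [Group B] [DecidableEq B] (F : ℕ → Finset B) : Prop where
  nonempty : ∀ i, (F i).Nonempty
  summable : ∀ b : B, Summable fun i => |1 - ((F i ∩ b • F i).card : ℝ) / ((F i).card : ℝ)|

/-- The vector `χ_F / (#F)^{1/2}` of `ℓ²(B)`. -/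
def normIndicator {B : Type*} (F : Finset B) : EllTwo B :=
  ⟨(F : Set B).indicator fun _ => ((1 / √(F.card : ℝ) : ℝ) : ℂ), (EllTwo.memℓp_iff _).2 <|
    summable_of_ne_finset_zero (s := F) fun x hx => by
      rw [Set.indicator_of_notMem (by simpa using hx)]
      simp⟩

theorem norm_normIndicator {B : Type*} (F : Finset B) (hF : F.Nonempty) :
    ‖normIndicator F‖ = 1 := by
  have hc : (0 : ℝ) < F.card := by exact_mod_cast hF.card_pos
  rw [EllTwo.norm_eq, tsum_eq_sum (s := F)]
  · have : ∀ x ∈ F, ‖normIndicator F x‖ ^ (2 : ℝ) = (F.card : ℝ)⁻¹ := by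
      intro x hx
      have : normIndicator F x = ((1 / √(F.card : ℝ) : ℝ) : ℂ) :=
        Set.indicator_of_mem (s := (F : Set B)) hx (fun _ => ((1 / √(F.card : ℝ) : ℝ) : ℂ))
      rw [this, Complex.norm_real, Real.rpow_two, Real.norm_eq_abs, sq_abs, div_pow,
        Real.sq_sqrt hc.le]
      simp
    rw [Finset.sum_congr rfl this]
    simp [hc.ne']
  · intro x hx
    have : normIndicator F x = 0 := Set.indicator_of_notMem (s := (F : Set B)) hx
      (fun _ => ((1 / √(F.card : ℝ) : ℝ) : ℂ))
    rw [this]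
    simp

/-- The sequence of unit vectors `φ i = χ_{F i} / (#(F i))^{1/2}`. -/
def indicatorSeq {B : Type*} (F : ℕ → Finset B) (hF : ∀ i, (F i).Nonempty) :
    UnitSeq fun _ : ℕ => EllTwo B where
  vec i := normIndicator (F i)
  norm_vec i := norm_normIndicator (F i) (hF i)

end

/-! Everything rests on one identity. Passing from `K` to a larger `J` moves an elementary vector
that agrees with `φ` off `K` by an amount whose square is `2 ∏ ‖ψ i‖² (1 - Re ∏ ⟪φ i, T i (φ i)⟫)`,
the last product running over `J \ K` (`norm_opOn_sub_opOn_sq`).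

For (i), convergence on `⊗ φ i` makes single-index increments small, so `‖T i (φ i) - φ i‖ → 0`.
Taking `a = 1` shows that the `φ i` are asymptotically invariant under translation. A translation
moving every `φ i` off its support moves it by `√2`, which forces `B` to be countable. The
probability densities `|φ i|²` give, along an ultrafilter, an invariant mean.

For (ii), `∑ |1 - ⟪φ i, T i (φ i)⟫| < ∞` makes the net Cauchy on elementary vectors, hence
everywhere, since its operators are isometries (`opExists_of_summable`). For normalized indicators
this defect is at most the Følner defect plus the average of `|1 - σ i (a, ·)|`. -/

namespace InfTensor

open Filter

/-! ### Convergence of the net of partial tensor operators. -/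

variable {H : ℕ → Type*} [∀ i, NormedAddCommGroup (H i)] [∀ i, InnerProductSpace ℂ (H i)]

/-- The product vector `⊗ φ i`. -/
def Elem.base (φ : UnitSeq H) : Elem φ := ⟨φ.vec, by simp⟩

/-- On `K` both vectors carry `T i`, which cancels by unitarity; on `J \ K` only the second does;
off `J` each factor is `⟪φ i, φ i⟫ = 1`. -/
theorem kernel_applyOn_applyOn (φ : UnitSeq H) (T : ∀ i, H i ≃ₗᵢ[ℂ] H i) {J K : Finset ℕ}
    (hKJ : K ⊆ J) (ψ : Elem φ) (hψ : ∀ i, i ∉ K → ψ.val i = φ.vec i) :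
    kernel φ (applyOn T K ψ) (applyOn T J ψ) =
      ((∏ i ∈ K, ‖ψ.val i‖ ^ 2 : ℝ) : ℂ) *
        ∏ i ∈ J \ K, inner ℂ (φ.vec i) (T i (φ.vec i)) := by
  rw [kernel_eq_prod φ _ _ J, ← Finset.prod_sdiff hKJ, mul_comm]
  · congr 1
    · rw [Complex.ofReal_prod]
      refine Finset.prod_congr rfl fun i hi => ?_
      simp [applyOn, hi, hKJ hi]
    · refine Finset.prod_congr rfl fun i hi => ?_
      obtain ⟨hJ, hK⟩ := Finset.mem_sdiff.1 hi
      simp [applyOn, hJ, hK, hψ i hK]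
  · intro i hi
    have hK : i ∉ K := fun h => hi (hKJ h)
    simp [applyOn, hK, hψ i hK]
  · intro i hi
    have hK : i ∉ K := fun h => hi (hKJ h)
    simp [applyOn, hi, hψ i hK]

theorem inner_tmul_eq_kernel {φ : UnitSeq H} (ψ ξ : Elem φ) :
    inner ℂ (tmul ψ) (tmul ξ) = kernel φ ψ ξ := inner_tmul ψ ξ

theorem norm_tmul_applyOn_sq (φ : UnitSeq H) (T : ∀ i, H i ≃ₗᵢ[ℂ] H i) (J : Finset ℕ)
    {K : Finset ℕ} (ψ : Elem φ) (hψ : ∀ i, i ∉ K → ψ.val i = φ.vec i) :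
    ‖tmul (applyOn T J ψ)‖ ^ 2 = ∏ i ∈ K, ‖ψ.val i‖ ^ 2 := by
  have h : ((‖tmul (applyOn T J ψ)‖ ^ 2 : ℝ) : ℂ) = ((∏ i ∈ K, ‖ψ.val i‖ ^ 2 : ℝ) : ℂ) := by
    have := inner_self_eq_norm_sq_to_K (𝕜 := ℂ) (tmul (applyOn T J ψ))
    rw [inner_tmul_eq_kernel, kernel_applyOn, kernel_eq_prod φ ψ ψ K hψ hψ] at this
    rw [Complex.ofReal_prod]
    push_cast
    refine this.symm.trans ?_
    refine Finset.prod_congr rfl fun i _ => ?_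
    simp [inner_self_eq_norm_sq_to_K]
  exact_mod_cast h

theorem norm_opOn_sub_opOn_sq (φ : UnitSeq H) (T : ∀ i, H i ≃ₗᵢ[ℂ] H i) {J K : Finset ℕ}
    (hKJ : K ⊆ J) (ψ : Elem φ) (hψ : ∀ i, i ∉ K → ψ.val i = φ.vec i) :
    ‖opOn φ T K (tmul ψ) - opOn φ T J (tmul ψ)‖ ^ 2 =
      2 * (∏ i ∈ K, ‖ψ.val i‖ ^ 2) *
        (1 - (∏ i ∈ J \ K, inner ℂ (φ.vec i) (T i (φ.vec i))).re) := by
  rw [opOn_tmul, opOn_tmul, @norm_sub_sq ℂ, norm_tmul_applyOn_sq φ T K ψ hψ,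
    norm_tmul_applyOn_sq φ T J ψ hψ, inner_tmul_eq_kernel,
    kernel_applyOn_applyOn φ T hKJ ψ hψ, RCLike.re_to_complex, Complex.re_ofReal_mul]
  ring

theorem norm_opOn (φ : UnitSeq H) (T : ∀ i, H i ≃ₗᵢ[ℂ] H i) (J : Finset ℕ) (v : Space φ) :
    ‖opOn φ T J v‖ = ‖v‖ := by
  induction v using UniformSpace.Completion.induction_on with
  | hp => exact isClosed_eq (by fun_prop) (by fun_prop)
  | ih f =>
    have : opOn φ T J (f : Space φ) = ((preOn φ T J f : Pre φ) : Space φ) :=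
      ContinuousLinearMap.completion_apply_coe _ _
    rw [this, UniformSpace.Completion.norm_coe, UniformSpace.Completion.norm_coe,
      LinearIsometry.norm_map]

/-- If `⊗ T i` exists, then `T i` asymptotically fixes the unit vectors `φ i`. -/
theorem OpExists.tendsto_norm_sub {φ : UnitSeq H} {T : ∀ i, H i ≃ₗᵢ[ℂ] H i}
    (h : OpExists φ T) : Tendsto (fun i => ‖T i (φ.vec i) - φ.vec i‖) atTop (𝓝 0) := by
  obtain ⟨S, hS⟩ := h
  have hc := (hS (tmul (Elem.base φ))).cauchySeq
  rw [Metric.cauchySeq_iff'] at hc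
  rw [Metric.tendsto_atTop]
  intro ε hε
  obtain ⟨K, hK⟩ := hc ε hε
  obtain ⟨N, hN⟩ := K.bddAbove
  refine ⟨N + 1, fun i hi => ?_⟩
  have hiK : i ∉ K := fun h => by
    have := hN h
    omega
  have h1 := hK (insert i K) (Finset.subset_insert i K)
  rw [dist_comm, dist_eq_norm] at h1
  have h2 := norm_opOn_sub_opOn_sq φ T (Finset.subset_insert i K) (Elem.base φ) (fun _ _ => rfl)
  have h3 : insert i K \ K = {i} := by
    rw [Finset.insert_sdiff_of_notMem _ hiK, sdiff_self]
    rfl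
  -- Both sides equal `2 (1 - Re ⟪φ i, T i (φ i)⟫)`.
  have h4 : ‖T i (φ.vec i) - φ.vec i‖ ^ 2 =
      ‖opOn φ T K (tmul (Elem.base φ)) - opOn φ T (insert i K) (tmul (Elem.base φ))‖ ^ 2 := by
    rw [h2, h3, Finset.prod_singleton, norm_sub_rev, @norm_sub_sq ℂ, LinearIsometryEquiv.norm_map]
    simp only [Elem.base, φ.norm_vec, RCLike.re_to_complex]
    norm_num
    ring
  have h5 := (sq_eq_sq₀ (norm_nonneg _) (norm_nonneg _)).1 h4
  rw [dist_zero_right, norm_norm, h5]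
  exact h1

/-- Turns the tail of a convergent series of defects into a bound on finite products, uniform in the
number of factors. -/
theorem norm_one_sub_prod_le {ι : Type*} (s : Finset ι) (z : ι → ℂ) (hz : ∀ i, ‖z i‖ ≤ 1) :
    ‖1 - ∏ i ∈ s, z i‖ ≤ ∑ i ∈ s, ‖1 - z i‖ := by
  classical
  induction s using Finset.induction_on with
  | empty => simp
  | insert i s hi ih =>
    rw [Finset.prod_insert hi, Finset.sum_insert hi]
    calc ‖1 - z i * ∏ j ∈ s, z j‖ = ‖(1 - z i) + z i * (1 - ∏ j ∈ s, z j)‖ := by ring_nf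
      _ ≤ ‖1 - z i‖ + ‖z i‖ * ‖1 - ∏ j ∈ s, z j‖ := by
        rw [← norm_mul]
        exact norm_add_le _ _
      _ ≤ _ := by
        have := mul_le_mul (hz i) ih (norm_nonneg _) zero_le_one
        linarith

theorem cauchySeq_opOn_tmul {φ : UnitSeq H} {T : ∀ i, H i ≃ₗᵢ[ℂ] H i}
    (h : Summable fun i => ‖1 - inner ℂ (φ.vec i) (T i (φ.vec i))‖) (ψ : Elem φ) :
    CauchySeq fun J : Finset ℕ => opOn φ T J (tmul ψ) := by
  rw [Metric.cauchySeq_iff']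
  intro ε hε
  set E := ψ.finite.toFinset
  have hE : ∀ i, i ∉ E → ψ.val i = φ.vec i := by simp [E]
  set C : ℝ := ∏ i ∈ E, ‖ψ.val i‖ ^ 2
  have hC : 0 ≤ C := Finset.prod_nonneg fun i _ => by positivity
  -- The squared distance will be `2 * C * t` with `t` below this threshold; the `+ 1` covers `C =
  -- 0`.
  obtain ⟨K, hK⟩ := summable_iff_vanishing_norm.1 h (ε ^ 2 / (2 * C + 1)) (by positivity)
  refine ⟨E ∪ K, fun J hJ => ?_⟩
  have hEK : ∀ i, i ∉ E ∪ K → ψ.val i = φ.vec i := fun i hi =>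
    hE i fun h => hi (Finset.mem_union_left _ h)
  -- Both products compute the squared norm of the same vector, with `T` applied nowhere: the extra
  -- factors come from unit vectors.
  have hprod : ∏ i ∈ E ∪ K, ‖ψ.val i‖ ^ 2 = C :=
    (norm_tmul_applyOn_sq φ T ∅ ψ hEK).symm.trans (norm_tmul_applyOn_sq φ T ∅ ψ hE)
  have hz : ∀ i, ‖(inner ℂ (φ.vec i) (T i (φ.vec i)) : ℂ)‖ ≤ 1 := fun i => by
    simpa [φ.norm_vec] using norm_inner_le_norm (𝕜 := ℂ) (φ.vec i) (T i (φ.vec i))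
  have hd := hK (J \ (E ∪ K)) (Finset.sdiff_disjoint.mono_right Finset.subset_union_right)
  rw [Real.norm_of_nonneg (Finset.sum_nonneg fun i _ => norm_nonneg _)] at hd
  have hle : 1 - (∏ i ∈ J \ (E ∪ K), inner ℂ (φ.vec i) (T i (φ.vec i)) : ℂ).re <
      ε ^ 2 / (2 * C + 1) := by
    refine lt_of_le_of_lt ?_ ((norm_one_sub_prod_le _ _ hz).trans_lt hd)
    simpa using Complex.re_le_norm
      (1 - ∏ i ∈ J \ (E ∪ K), inner ℂ (φ.vec i) (T i (φ.vec i)))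
  have hsq := norm_opOn_sub_opOn_sq φ T hJ ψ hEK
  rw [hprod] at hsq
  rw [dist_comm, dist_eq_norm]
  refine lt_of_pow_lt_pow_left₀ 2 hε.le ?_
  rw [hsq]
  rw [lt_div_iff₀ (by positivity)] at hle
  have hpos : 0 < ε ^ 2 := by positivity
  generalize 1 - (∏ i ∈ J \ (E ∪ K), inner ℂ (φ.vec i) (T i (φ.vec i)) : ℂ).re = t at hle ⊢
  by_cases ht : 0 < t
  · linarith
  · nlinarith [mul_nonneg hC (neg_nonneg.2 (not_lt.1 ht))]

theorem coe_eq_sum_tmul {φ : UnitSeq H} (f : Pre φ) :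
    (f : Space φ) = ∑ ψ ∈ f.support, f ψ • tmul ψ := by
  conv_lhs => rw [← Finsupp.sum_single f]
  rw [Finsupp.sum]
  have hmap := map_sum (UniformSpace.Completion.toComplL (𝕜 := ℂ) (E := Pre φ))
    (fun ψ => Finsupp.single ψ (f ψ)) f.support
  simp only [UniformSpace.Completion.coe_toComplL] at hmap
  rw [hmap]
  refine Finset.sum_congr rfl fun ψ _ => ?_
  rw [tmul, ← UniformSpace.Completion.coe_smul, Finsupp.smul_single, smul_eq_mul, mul_one]

/-- The operators are isometries, so the Cauchy property passes from the dense span of elementary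
vectors to its completion by an `ε / 3` argument. -/
theorem exists_tendsto_opOn {φ : UnitSeq H} {T : ∀ i, H i ≃ₗᵢ[ℂ] H i}
    (h : Summable fun i => ‖1 - inner ℂ (φ.vec i) (T i (φ.vec i))‖) (v : Space φ) :
    ∃ w, Tendsto (fun J : Finset ℕ => opOn φ T J v) atTop (𝓝 w) := by
  have hpre : ∀ f : Pre φ, CauchySeq fun J : Finset ℕ => opOn φ T J (f : Space φ) := by
    intro f
    choose w hw using fun ψ => cauchySeq_tendsto_of_complete (cauchySeq_opOn_tmul h ψ)
    refine Tendsto.cauchySeq (x := ∑ ψ ∈ f.support, f ψ • w ψ) ?_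
    simp only [coe_eq_sum_tmul f, map_sum, map_smul]
    exact tendsto_finsetSum _ fun ψ _ => (hw ψ).const_smul (f ψ)
  refine cauchySeq_tendsto_of_complete (Metric.cauchySeq_iff'.2 fun ε hε => ?_)
  obtain ⟨f, hf⟩ := UniformSpace.Completion.denseRange_coe.exists_dist_lt v
    (show (0 : ℝ) < ε / 3 by positivity)
  obtain ⟨K, hK⟩ := Metric.cauchySeq_iff'.1 (hpre f) (ε / 3) (by positivity)
  refine ⟨K, fun J hJ => ?_⟩
  have hiso : ∀ L : Finset ℕ, dist (opOn φ T L v) (opOn φ T L (f : Space φ)) < ε / 3 := fun L => by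
    rwa [dist_eq_norm, ← map_sub, norm_opOn, ← dist_eq_norm]
  calc dist (opOn φ T J v) (opOn φ T K v)
      ≤ dist (opOn φ T J v) (opOn φ T J (f : Space φ)) +
          dist (opOn φ T J (f : Space φ)) (opOn φ T K (f : Space φ)) +
          dist (opOn φ T K (f : Space φ)) (opOn φ T K v) := dist_triangle4 _ _ _ _
    _ < ε := by
      have h1 := hiso J
      have h2 := hK J hJ
      have h3 := hiso K
      rw [dist_comm] at h3
      linarith

/-- If `∑ i, |1 - ⟪φ i, T i φ i⟫|` converges, then `⊗ T i` exists. -/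
theorem opExists_of_summable {φ : UnitSeq H} {T : ∀ i, H i ≃ₗᵢ[ℂ] H i}
    (h : Summable fun i => ‖1 - inner ℂ (φ.vec i) (T i (φ.vec i))‖) : OpExists φ T := by
  choose S hS using exists_tendsto_opOn h
  refine ⟨LinearMap.mkContinuous ⟨⟨S, fun v w => ?_⟩, fun c v => ?_⟩ 1 fun v => ?_, hS⟩
  · refine tendsto_nhds_unique (hS (v + w)) ?_
    simpa only [map_add] using (hS v).add (hS w)
  · refine tendsto_nhds_unique (hS (c • v)) ?_
    simpa only [map_smul, RingHom.id_apply] using (hS v).const_smul c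
  · rw [one_mul]
    refine le_of_tendsto (hS v).norm (Eventually.of_forall fun J => (norm_opOn φ T J v).le)

end InfTensor

/-! ### Asymptotically invariant vectors and countability. -/

theorem ccrRep_apply {A B : Type*} [Group A] [Group B] (σ : A →* B →* Circle) (g : A × B)
    (f : EllTwo B) (x : B) : ccrRep σ g f x = (σ g.1 x : ℂ) * f (g.2⁻¹ * x) := rfl

theorem leftReg_apply {B : Type*} [Group B] (b : B) (f : EllTwo B) (x : B) :
    leftReg b f x = f (b⁻¹ * x) := rfl

theorem ccrRep_one_left {A B : Type*} [Group A] [Group B] (σ : A →* B →* Circle) (b : B)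
    (f : EllTwo B) : ccrRep σ (1, b) f = leftReg b f := by
  ext x
  simp [ccrRep_apply, leftReg_apply]

theorem EllTwo.summable_norm_sq {B : Type*} (f : EllTwo B) : Summable fun x => ‖f x‖ ^ 2 := by
  simpa using (EllTwo.memℓp_iff _).1 f.2

theorem EllTwo.norm_sq_eq_tsum {B : Type*} (f : EllTwo B) : ‖f‖ ^ 2 = ∑' x, ‖f x‖ ^ 2 := by
  simpa using lp.norm_rpow_eq_tsum (p := 2) (by norm_num) f

theorem EllTwo.summable_and_tsum_mul_le {B : Type*} (f g : EllTwo B) :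
    (Summable fun x => ‖f x‖ * ‖g x‖) ∧ ∑' x, ‖f x‖ * ‖g x‖ ≤ ‖f‖ * ‖g‖ := by
  rw [EllTwo.norm_eq f, EllTwo.norm_eq g]
  exact Real.summable_and_inner_le_Lp_mul_Lq_tsum_of_nonneg Real.HolderConjugate.two_two
    (fun _ => norm_nonneg _) (fun _ => norm_nonneg _) ((EllTwo.memℓp_iff _).1 f.2)
    ((EllTwo.memℓp_iff _).1 g.2)

/-- A group with a sequence of asymptotically invariant unit vectors in `ℓ²(B)` is countable. -/
theorem countable_of_tendsto_leftReg {B : Type*} [Group B] (φ : UnitSeq fun _ : ℕ => EllTwo B)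
    (h : ∀ b, Filter.Tendsto (fun i => ‖leftReg b (φ.vec i) - φ.vec i‖) Filter.atTop (𝓝 0)) :
    Countable B := by
  set s : Set B := ⋃ i, {x | φ.vec i x ≠ 0}
  have hs : s.Countable := Set.countable_iUnion fun i =>
    ((φ.vec i).summable_norm_sq.countable_support).mono fun x hx => by
      simpa [Function.mem_support] using hx
  have hs' : (s⁻¹).Countable := hs.preimage inv_injective
  -- If `b ∉ s * s⁻¹`, each `φ i` and its translate by `b` have disjoint supports, so they are
  -- orthogonal unit vectors and cannot become close.
  have hu : (Set.univ : Set B) ⊆ s * s⁻¹ := by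
    intro b _
    by_contra hb
    have hne : ∀ i, inner ℂ (leftReg b (φ.vec i)) (φ.vec i) = (0 : ℂ) := by
      intro i
      rw [lp.inner_eq_tsum]
      refine (tsum_congr fun x => ?_).trans tsum_zero
      rw [leftReg_apply]
      by_cases h1 : φ.vec i (b⁻¹ * x) = 0
      · simp [h1]
      by_cases h2 : φ.vec i x = 0
      · simp [h2]
      refine absurd ?_ hb
      refine Set.mem_mul.2 ⟨x, Set.mem_iUnion.2 ⟨i, h2⟩, (b⁻¹ * x)⁻¹, ?_, by group⟩
      rw [Set.inv_mem_inv]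
      exact Set.mem_iUnion.2 ⟨i, h1⟩
    have h1 : ∀ i, 1 ≤ ‖leftReg b (φ.vec i) - φ.vec i‖ := by
      intro i
      have := @norm_sub_sq ℂ _ _ _ _ (leftReg b (φ.vec i)) (φ.vec i)
      rw [hne i, LinearIsometryEquiv.norm_map, φ.norm_vec, map_zero] at this
      nlinarith [norm_nonneg (leftReg b (φ.vec i) - φ.vec i)]
    have := ge_of_tendsto' (h b) h1
    linarith
  exact Set.countable_univ_iff.1 ((hs.image2 hs' _).mono hu)

/-! ### Means given by vectors, and amenability. -/

/-- The mean `f ↦ ∑ x, f x |ψ x|²` on `ℓ^∞(B)`. -/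
noncomputable def vectorMean {B : Type*} (ψ : EllTwo B) (f : lp (fun _ : B => ℝ) ∞) : ℝ :=
  ∑' x, f x * ‖ψ x‖ ^ 2

section vectorMean

variable {B : Type*}

theorem summable_vectorMean (ψ : EllTwo B) (f : lp (fun _ : B => ℝ) ∞) :
    Summable fun x => f x * ‖ψ x‖ ^ 2 :=
  Summable.of_norm_bounded (ψ.summable_norm_sq.mul_left ‖f‖) fun x => by
    rw [norm_mul, norm_pow, norm_norm]
    gcongr
    exact lp.norm_apply_le_norm (by simp) f x

theorem vectorMean_add (ψ : EllTwo B) (f g : lp (fun _ : B => ℝ) ∞) :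
    vectorMean ψ (f + g) = vectorMean ψ f + vectorMean ψ g := by
  unfold vectorMean
  rw [← (summable_vectorMean ψ f).tsum_add (summable_vectorMean ψ g)]
  exact tsum_congr fun x => add_mul _ _ _

theorem vectorMean_smul (ψ : EllTwo B) (c : ℝ) (f : lp (fun _ : B => ℝ) ∞) :
    vectorMean ψ (c • f) = c * vectorMean ψ f := by
  unfold vectorMean
  rw [← tsum_mul_left]
  exact tsum_congr fun x => mul_assoc _ _ _

theorem vectorMean_one (ψ : EllTwo B) : vectorMean ψ 1 = ‖ψ‖ ^ 2 := by
  rw [ψ.norm_sq_eq_tsum]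
  exact tsum_congr fun x => one_mul _

theorem vectorMean_nonneg (ψ : EllTwo B) {f : lp (fun _ : B => ℝ) ∞} (hf : ∀ x, 0 ≤ f x) :
    0 ≤ vectorMean ψ f :=
  tsum_nonneg fun x => mul_nonneg (hf x) (by positivity)

theorem abs_vectorMean_le (ψ : EllTwo B) (f : lp (fun _ : B => ℝ) ∞) :
    |vectorMean ψ f| ≤ ‖f‖ * ‖ψ‖ ^ 2 := by
  rw [ψ.norm_sq_eq_tsum, ← tsum_mul_left, ← Real.norm_eq_abs]
  refine tsum_of_norm_bounded (ψ.summable_norm_sq.mul_left ‖f‖).hasSum fun x => ?_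
  rw [norm_mul, norm_pow, norm_norm]
  gcongr
  exact lp.norm_apply_le_norm (by simp) f x

theorem vectorMean_leftReg [Group B] (b : B) (ψ : EllTwo B) {f g : lp (fun _ : B => ℝ) ∞}
    (hg : ∀ x, g x = f (b⁻¹ * x)) : vectorMean (leftReg b ψ) g = vectorMean ψ f := by
  unfold vectorMean
  simp only [hg, leftReg_apply]
  exact (Equiv.mulLeft b⁻¹).tsum_eq fun x => f x * ‖ψ x‖ ^ 2

/-- Factor `|ψ|² - |ξ|²` as a difference of squares and apply Cauchy–Schwarz: nearby vectors give
nearby means. -/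
theorem abs_vectorMean_sub_le (ψ ξ : EllTwo B) (f : lp (fun _ : B => ℝ) ∞) :
    |vectorMean ψ f - vectorMean ξ f| ≤ ‖f‖ * (‖ψ - ξ‖ * (‖ψ‖ + ‖ξ‖)) := by
  obtain ⟨hs₁, hle₁⟩ := EllTwo.summable_and_tsum_mul_le (ψ - ξ) ψ
  obtain ⟨hs₂, hle₂⟩ := EllTwo.summable_and_tsum_mul_le (ψ - ξ) ξ
  have hs : Summable fun x => ‖(ψ - ξ) x‖ * (‖ψ x‖ + ‖ξ x‖) := by
    simpa only [mul_add] using hs₁.add hs₂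
  have hle : ∑' x, ‖(ψ - ξ) x‖ * (‖ψ x‖ + ‖ξ x‖) ≤ ‖ψ - ξ‖ * (‖ψ‖ + ‖ξ‖) := by
    simp only [mul_add]
    rw [hs₁.tsum_add hs₂]
    exact add_le_add hle₁ hle₂
  unfold vectorMean
  rw [← (summable_vectorMean ψ f).tsum_sub (summable_vectorMean ξ f), ← Real.norm_eq_abs]
  refine (tsum_of_norm_bounded (hs.mul_left ‖f‖).hasSum fun x => ?_).trans ?_
  · rw [← mul_sub, norm_mul]
    gcongr
    · exact lp.norm_apply_le_norm (by simp) f x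
    · have : ‖ψ x‖ ^ 2 - ‖ξ x‖ ^ 2 = (‖ψ x‖ - ‖ξ x‖) * (‖ψ x‖ + ‖ξ x‖) := by ring
      rw [this, norm_mul, Real.norm_of_nonneg (by positivity : 0 ≤ ‖ψ x‖ + ‖ξ x‖)]
      gcongr
      exact abs_norm_sub_norm_le _ _
  · rw [tsum_mul_left]
    gcongr

end vectorMean

/-- A group with a sequence of asymptotically invariant unit vectors in `ℓ²(B)` is amenable. -/
theorem isAmenable_of_tendsto_leftReg {B : Type*} [Group B] (φ : UnitSeq fun _ : ℕ => EllTwo B)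
    (h : ∀ b, Filter.Tendsto (fun i => ‖leftReg b (φ.vec i) - φ.vec i‖) Filter.atTop (𝓝 0)) :
    IsAmenable B := by
  -- One ultrafilter finer than `atTop` serves all `f`: the bounded values converge along it, and
  -- uniqueness of limits gives linearity.
  set U : Ultrafilter ℕ := Filter.hyperfilter ℕ
  have hU : (U : Filter ℕ) ≤ Filter.atTop := Nat.hyperfilter_le_atTop
  have hlim : ∀ f : lp (fun _ : B => ℝ) ∞,
      ∃ t, Filter.Tendsto (fun i => vectorMean (φ.vec i) f) U (𝓝 t) := by
    intro f
    obtain ⟨t, -, ht⟩ := (isCompact_Icc (a := -‖f‖) (b := ‖f‖)).ultrafilter_le_nhds'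
      (U.map fun i => vectorMean (φ.vec i) f) <|
        Ultrafilter.mem_map.2 <| Filter.univ_mem' fun i => by
          have := abs_vectorMean_le (φ.vec i) f
          rw [φ.norm_vec, one_pow, mul_one] at this
          exact abs_le.1 this
    exact ⟨t, ht⟩
  choose m hm using hlim
  refine ⟨⟨⟨m, fun f g => ?_⟩, fun c f => ?_⟩, fun f hf => ?_, ?_, fun b f g hfg => ?_⟩
  · refine tendsto_nhds_unique (hm (f + g)) ?_
    simpa only [vectorMean_add] using (hm f).add (hm g)
  · refine tendsto_nhds_unique (hm (c • f)) ?_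
    simpa only [vectorMean_smul, RingHom.id_apply, smul_eq_mul] using (hm f).const_mul c
  · exact ge_of_tendsto' (hm f) fun i => vectorMean_nonneg _ hf
  · refine tendsto_nhds_unique (hm 1) ?_
    simp [vectorMean_one, φ.norm_vec]
  · have h0 : Filter.Tendsto
        (fun i => vectorMean (φ.vec i) g - vectorMean (φ.vec i) f) U (𝓝 0) := by
      have hb : Filter.Tendsto (fun i => ‖g‖ * (‖leftReg b (φ.vec i) - φ.vec i‖ * 2)) U (𝓝 0) := by
        simpa using (((h b).mono_left hU).mul_const 2).const_mul ‖g‖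
      refine squeeze_zero_norm (fun i => ?_) hb
      -- Moving the translation from the function to the vector leaves two means of the same `g`;
      -- the factor `2` is the sum of the two unit norms.
      rw [← vectorMean_leftReg b (φ.vec i) hfg, Real.norm_eq_abs]
      refine (abs_vectorMean_sub_le _ _ _).trans_eq ?_
      rw [LinearIsometryEquiv.norm_map, φ.norm_vec, norm_sub_rev]
      norm_num
    exact sub_eq_zero.1 (tendsto_nhds_unique ((hm g).sub (hm f)) h0)

/-! ### Matrix coefficients at normalized indicators. -/

theorem normIndicator_apply_of_mem {B : Type*} {F : Finset B} {x : B} (hx : x ∈ F) :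
    normIndicator F x = ((1 / √(F.card : ℝ) : ℝ) : ℂ) :=
  Set.indicator_of_mem (s := (F : Set B)) hx fun _ => ((1 / √(F.card : ℝ) : ℝ) : ℂ)

theorem normIndicator_apply_of_notMem {B : Type*} {F : Finset B} {x : B} (hx : x ∉ F) :
    normIndicator F x = 0 :=
  Set.indicator_of_notMem (s := (F : Set B)) hx fun _ => ((1 / √(F.card : ℝ) : ℝ) : ℂ)

/-- A point `x` contributes only if both `x` and `b⁻¹ * x` lie in `F`. -/
theorem inner_normIndicator_ccrRep {A B : Type*} [Group A] [Group B] [DecidableEq B]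
    (σ : A →* B →* Circle) (a : A) (b : B) (F : Finset B) :
    inner ℂ (normIndicator F) (ccrRep σ (a, b) (normIndicator F)) =
      (1 / (F.card : ℂ)) * ∑ x ∈ F ∩ b • F, (σ a x : ℂ) := by
  rw [lp.inner_eq_tsum, tsum_eq_sum (s := F ∩ b • F), Finset.mul_sum]
  · refine Finset.sum_congr rfl fun x hx => ?_
    obtain ⟨h1, h2⟩ := Finset.mem_inter.1 hx
    have h3 : b⁻¹ * x ∈ F := by simpa using Finset.inv_smul_mem_iff.2 h2
    rw [ccrRep_apply, normIndicator_apply_of_mem h1, normIndicator_apply_of_mem h3]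
    have hsq : ((1 / √(F.card : ℝ) : ℝ) : ℂ) * ((1 / √(F.card : ℝ) : ℝ) : ℂ) =
        1 / (F.card : ℂ) := by
      rw [← Complex.ofReal_mul, ← sq, div_pow, Real.sq_sqrt (Nat.cast_nonneg _)]
      simp
    simp only [RCLike.inner_apply, Complex.conj_ofReal]
    rw [← hsq]
    ring
  · intro x hx
    rw [ccrRep_apply]
    by_cases h1 : x ∈ F
    · have h3 : b⁻¹ * x ∉ F := fun h3 => hx (Finset.mem_inter.2
        ⟨h1, Finset.inv_smul_mem_iff.1 (by simpa using h3)⟩)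
      simp [normIndicator_apply_of_notMem h3]
    · simp [normIndicator_apply_of_notMem h1]

theorem norm_one_sub_inner_normIndicator_le {A B : Type*} [Group A] [Group B] [DecidableEq B]
    (σ : A →* B →* Circle) (a : A) (b : B) {F : Finset B} (hF : F.Nonempty) :
    ‖1 - inner ℂ (normIndicator F) (ccrRep σ (a, b) (normIndicator F))‖ ≤
      |1 - ((F ∩ b • F).card : ℝ) / (F.card : ℝ)| +
        1 / (F.card : ℝ) * ∑ x ∈ F, ‖1 - (σ a x : ℂ)‖ := by
  -- Writing `σ a x = 1 - (1 - σ a x)` separates the Følner defect, where `σ` is absent, from the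
  -- phase defect.
  have hsplit : 1 - (1 / (F.card : ℂ)) * ∑ x ∈ F ∩ b • F, (σ a x : ℂ) =
      ((1 - ((F ∩ b • F).card : ℝ) / (F.card : ℝ) : ℝ) : ℂ) +
        (1 / (F.card : ℂ)) * ∑ x ∈ F ∩ b • F, (1 - (σ a x : ℂ)) := by
    rw [Finset.sum_sub_distrib]
    simp only [Finset.sum_const, nsmul_eq_mul, mul_one]
    push_cast
    ring
  rw [inner_normIndicator_ccrRep, hsplit]
  refine (norm_add_le _ _).trans ?_
  rw [Complex.norm_real, Real.norm_eq_abs, norm_mul, norm_div, norm_one, Complex.norm_natCast]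
  gcongr
  exact (norm_sum_le _ _).trans (Finset.sum_le_sum_of_subset_of_nonneg Finset.inter_subset_left
    fun _ _ _ => norm_nonneg _)

theorem theorem3p6 {A B : Type*} [Group A] [Group B] [DecidableEq B]
    (σ : ℕ → A →* B →* Circle) :
    (∀ φ : UnitSeq (fun _ : ℕ => EllTwo B),
      InfTensor.RepExists φ (fun i => ccrRep (σ i)) → Countable B ∧ IsAmenable B) ∧
    (Countable B → IsAmenable B →
      ∀ (F : ℕ → Finset B) (hF : IsSigmaFSeq F),
        (∀ a : A, Summable fun i =>
          1 / ((F i).card : ℝ) * ∑ b ∈ F i, ‖1 - (σ i a b : ℂ)‖) →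
        InfTensor.RepExists (indicatorSeq F hF.nonempty) (fun i => ccrRep (σ i))) := by
  refine ⟨fun φ h => ?_, fun _ _ F hF hσ g => ?_⟩
  · have ht : ∀ b, Filter.Tendsto (fun i => ‖leftReg b (φ.vec i) - φ.vec i‖)
        Filter.atTop (𝓝 0) := fun b => by
      simpa only [ccrRep_one_left] using (h (1, b)).tendsto_norm_sub
    exact ⟨countable_of_tendsto_leftReg φ ht, isAmenable_of_tendsto_leftReg φ ht⟩
  · refine InfTensor.opExists_of_summable ?_
    exact Summable.of_nonneg_of_le (fun _ => norm_nonneg _)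
      (fun i => norm_one_sub_inner_normIndicator_le (σ i) g.1 g.2 (hF.nonempty i))
      ((hF.summable g.2).add (hσ g.1))
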